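/- Fix an integer $k\ge 1$. For $n\ge 2k$ let $J(n,k)$ be the Johnson graph: its $N=\binom nk$ vertices are the $k$-subsets of $\{1,\dots,n\}$, and $v,v'$ are adjacent iff $|v\cap v'|=k-1$. Let $A$ be its adjacency operator on the Hilbert space with orthonormal basis $\{|v\rangle\}$, let $w$ be a marked vertex, and for real $\gamma$ let $H=-\gamma A-|w\rangle\langle w|$. Let $|s\rangle=\frac1{\sqrt N}\sum_v|v\rangle$ and $|\psi(t)\rangle=e^{-iHt}|s\rangle$. Put $\epsilon=1/\sqrt n$ and, for $0\le\ell\le k$, $$r_\ell(\epsilon)=(k-\ell)\bigl(1-(k+\ell)\epsilon^2\bigr)-\ell\epsilon^2,\qquad p_\ell(\epsilon)=\epsilon^{k-\ell}\sqrt{\frac{k!\,(1-(2\ell-1)\epsilon^2)}{\ell!\,\prod_{j=\ell-1}^{k-1}(1-j\epsilon^2)}},$$ $$\gamma^\circ(\epsilon)=\epsilon^2\sum_{\ell=1}^k\frac{p_\ell(\epsilon)^2}{r_0(\epsilon)-r_\ell(\epsilon)},\qquad t_{\mathrm{run}}=\frac{\pi n^{k/2}}{2\sqrt{k!}}.$$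 Then: 1. For all $n\ge 2k$ we have $\gamma^\circ(1/\sqrt n)>0$, and for $0\le\ell\le k$ and every vertex $w$, $r_\ell(1/\sqrt n)=\lambda_\ell/n$ and $p_\ell(1/\sqrt n)=\|P_\ell|w\rangle\|$, where $\lambda_\ell=(k-\ell)(n-k-\ell)-\ell$ and $P_\ell$ is the orthogonal projector onto the eigenspace of $A$ for $\lambda_\ell$. 2. $t_{\mathrm{run}}\big/\bigl(\tfrac{\pi}{2}\sqrt N\bigr)\to 1$ as $n\to\infty$. 3. With $\gamma=\gamma^\circ(1/\sqrt n)$, the success probability satisfies $|\langle w|\psi(t_{\mathrm{run}})\rangle|^2=1+o(1)$ as $n\to\infty$, uniformly in the marked vertex $w$. -/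

import Mathlib

open Filter Topology

noncomputable section

namespace JohnsonSearch

/-- The vertices of `J(n,k)`: the `k`-subsets of an `n`-set. -/
abbrev Vertex (n k : ℕ) : Type := {v : Finset (Fin n) // v.card = k}

/-- The Johnson graph `J(n,k)`: `v` and `v'` are adjacent iff `|v ∩ v'| = k - 1`
(written without subtraction). -/
def johnsonGraph (n k : ℕ) : SimpleGraph (Vertex n k) where
  Adj v v' := (v.1 ∩ v'.1).card + 1 = k
  symm := ⟨fun v v' h => by rw [Finset.inter_comm]; exact h⟩
  loopless := ⟨fun v h => by
    rw [Finset.inter_self, v.2] at h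
    omega⟩

instance (n k : ℕ) : DecidableRel (johnsonGraph n k).Adj :=
  fun v v' => inferInstanceAs (Decidable ((v.1 ∩ v'.1).card + 1 = k))

/-- The Hilbert space with orthonormal basis `|v⟩`, `v` a vertex of `J(n,k)`. -/
abbrev State (n k : ℕ) : Type := EuclideanSpace ℂ (Vertex n k)

/-- The basis state `|v⟩`. -/
def ket {n k : ℕ} (v : Vertex n k) : State n k := EuclideanSpace.single v 1

/-- The adjacency operator `A` of `J(n,k)`. -/
def adjOp (n k : ℕ) : State n k →L[ℂ] State n k :=
  Matrix.toEuclideanCLM (n := Vertex n k) (𝕜 := ℂ) ((johnsonGraph n k).adjMatrix ℂ)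

/-- The Hamiltonian `H = -γ A - |w⟩⟨w|`. -/
def hamiltonian {n k : ℕ} (γ : ℝ) (w : Vertex n k) : State n k →L[ℂ] State n k :=
  -((γ : ℂ) • adjOp n k) - InnerProductSpace.rankOne ℂ (ket w) (ket w)

/-- The uniform superposition `|s⟩`. -/
def uniformState (n k : ℕ) : State n k :=
  ((1 / √(n.choose k : ℝ) : ℝ) : ℂ) • ∑ v : Vertex n k, ket v

/-- The state `ψ(t) = exp(-iHt)|s⟩` at time `t`. -/
def stateAt {n k : ℕ} (γ : ℝ) (w : Vertex n k) (t : ℝ) : State n k :=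
  NormedSpace.exp ((-Complex.I * (t : ℂ)) • hamiltonian γ w) (uniformState n k)

/-- The probability `|⟨w|ψ(t)⟩|²` of measuring `w` at time `t`. -/
def successProb {n k : ℕ} (γ : ℝ) (w : Vertex n k) (t : ℝ) : ℝ :=
  ‖inner ℂ (ket w) (stateAt γ w t)‖ ^ 2

/-- `λ_ℓ = (k-ℓ)(n-k-ℓ) - ℓ`. -/
def eigenval (n k l : ℕ) : ℝ := ((k : ℝ) - l) * ((n : ℝ) - k - l) - l

/-- The orthogonal projector `P_ℓ` onto the eigenspace of `A` for `λ_ℓ`. -/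
def eigenProj (n k l : ℕ) : State n k →L[ℂ] State n k :=
  (Module.End.eigenspace (adjOp n k).toLinearMap ((eigenval n k l : ℝ) : ℂ)).starProjection

/-- `r_ℓ(ε) = (k-ℓ)(1-(k+ℓ)ε²) - ℓε²`. -/
def r (k l : ℕ) (ε : ℝ) : ℝ :=
  ((k : ℝ) - l) * (1 - ((k : ℝ) + l) * ε ^ 2) - l * ε ^ 2

/-- `p_ℓ(ε) = ε^(k-ℓ) √(k! (1-(2ℓ-1)ε²) / (ℓ! (1-(ℓ-1)ε²) ⋯ (1-(k-1)ε²)))`, for `ℓ ≤ k`. -/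
def p (k l : ℕ) (ε : ℝ) : ℝ :=
  ε ^ (k - l) *
    √((k.factorial * (1 - (2 * (l : ℝ) - 1) * ε ^ 2)) /
      (l.factorial * ∏ j ∈ Finset.Icc l k, (1 - ((j : ℝ) - 1) * ε ^ 2)))

/-- `γ°(ε) = ε² ∑_{ℓ=1}^k p_ℓ(ε)² / (r_0(ε) - r_ℓ(ε))`. -/
def gammaCirc (k : ℕ) (ε : ℝ) : ℝ :=
  ε ^ 2 * ∑ l ∈ Finset.Icc 1 k, p k l ε ^ 2 / (r k 0 ε - r k l ε)

/-- `ε = 1/√n`. -/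
def eps (n : ℕ) : ℝ := 1 / √(n : ℝ)

/-- `t_run = π n^(k/2) / (2 √(k!))`. -/
def runTime (n k : ℕ) : ℝ :=
  Real.pi * (n : ℝ) ^ ((k : ℝ) / 2) / (2 * √(k.factorial : ℝ))

end JohnsonSearch

end

/-!
The vectors counting the `j`-subsets of `v ∩ w`, and those counting the `j`-subsets of `v ∩ wᶜ`, are
both ladders: the adjacency operator is bidiagonal on them, with diagonal `λ_j`. Climbing the first
from rung `ℓ` to the top rung `|w⟩` makes `P_ℓ|w⟩` a multiple of `P_ℓ` of rung `ℓ`, which up to sign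
is `P_ℓ` of rung `ℓ` of the second ladder. The latter is an explicit eigenvector, whose component at
`w` gives `‖P_ℓ|w⟩‖² = ⟨w|P_ℓ|w⟩`.

At `γ°` the state `|b⟩ = ∑_{ℓ≥1} P_ℓ|w⟩ / (γ°(λ_0 - λ_ℓ))` satisfies `⟨w|b⟩ = 1`. With `E = -γ°λ_0`
it follows that `(H - E)|b⟩ = -|s⟩/√N` and `(H - E)|s⟩ = -|w⟩/√N`. If `|b⟩` were `|w⟩`, then `H`
would rotate `|s⟩` into `|w⟩` at angular speed `1/√N`; by Duhamel's formula the error of this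
approximation up to time `T` is at most `(T/√N) ‖b - w‖`. Finally
`‖b - w‖² = S_2/S_1² - 1` with `S_j = ∑_{ℓ≥1} p_ℓ²/(r_0 - r_ℓ)^j → k^{-j}`, so the error vanishes.
-/

noncomputable section

namespace JohnsonSearch

section Ladder

variable {K V : Type*} [Field K] [AddCommGroup V] [Module K V]

/-- A ladder for `A`: vectors on which `A` is lower bidiagonal, `A u_j = μ_j u_j + b_{j-1} u_{j-1}`.
It determines the spectral components of its rungs. -/
structure IsLadder (A : Module.End K V) (μ b : ℕ → K) (u : ℕ → V) : Prop where
  zero : A (u 0) = μ 0 • u 0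
  succ (j : ℕ) : A (u (j + 1)) = μ (j + 1) • u (j + 1) + b j • u j

/-- The coefficient of `u_j` in the eigenvector `u_l + …` that a ladder yields for `μ_l`. -/
def ladderCoeff (μ b : ℕ → K) (l j : ℕ) : K := ∏ i ∈ Finset.Ico j l, b i / (μ l - μ i)

theorem ladderCoeff_self (μ b : ℕ → K) (l : ℕ) : ladderCoeff μ b l l = 1 := by
  simp [ladderCoeff]

theorem sub_mul_ladderCoeff {μ : ℕ → K} {l j : ℕ} (hj : j < l) (hμ : μ j ≠ μ l) (b : ℕ → K) :
    (μ l - μ j) * ladderCoeff μ b l j = b j * ladderCoeff μ b l (j + 1) := by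
  rw [ladderCoeff, Finset.prod_eq_prod_Ico_succ_bot hj, ladderCoeff, ← mul_assoc,
    mul_div_cancel₀ _ (sub_ne_zero.2 hμ.symm)]

/-- The eigenvector for `μ_l` in the span of the rungs `u_0, …, u_l` of a ladder. -/
def ladderEigenvector (μ b : ℕ → K) (u : ℕ → V) (l : ℕ) : V :=
  ∑ j ∈ Finset.range (l + 1), ladderCoeff μ b l j • u j

namespace IsLadder

variable {A : Module.End K V} {μ b : ℕ → K} {u : ℕ → V}

theorem sum_ladderCoeff_smul_sub (h : IsLadder A μ b u) {l m : ℕ} (hm : m ≤ l)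
    (hμ : ∀ i < l, μ i ≠ μ l) :
    ∑ j ∈ Finset.range (m + 1), ladderCoeff μ b l j • (A (u j) - μ l • u j) =
      (ladderCoeff μ b l m * (μ m - μ l)) • u m := by
  induction m with
  | zero => simp [h.zero, mul_smul, sub_smul]
  | succ m ih =>
    have hcancel : ladderCoeff μ b l m * (μ m - μ l) + ladderCoeff μ b l (m + 1) * b m = 0 := by
      linear_combination -sub_mul_ladderCoeff hm (hμ m hm) b
    rw [Finset.sum_range_succ, ih (by omega), h.succ, eq_neg_of_add_eq_zero_left hcancel]
    module

theorem map_ladderEigenvector (h : IsLadder A μ b u) {l : ℕ} (hμ : ∀ i < l, μ i ≠ μ l) :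
    A (ladderEigenvector μ b u l) = μ l • ladderEigenvector μ b u l := by
  have hsum := h.sum_ladderCoeff_smul_sub le_rfl hμ
  simp only [sub_self, mul_zero, zero_smul, smul_sub, Finset.sum_sub_distrib] at hsum
  rw [ladderEigenvector, map_sum, Finset.smul_sum]
  simpa only [map_smul, smul_comm (μ l)] using sub_eq_zero.1 hsum

section Map

variable {W : Type*} [AddCommGroup W] [Module K W] {l : ℕ} {P : V →ₗ[K] W}

theorem sub_smul_map_succ (h : IsLadder A μ b u) (hP : ∀ x, P (A x) = μ l • P x) (j : ℕ) :
    (μ l - μ (j + 1)) • P (u (j + 1)) = b j • P (u j) := by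
  rw [sub_smul, ← hP, h.succ, map_add, map_smul, map_smul, add_sub_cancel_left]

theorem map_eq_zero_of_lt (h : IsLadder A μ b u) (hP : ∀ x, P (A x) = μ l • P x)
    (hμ : ∀ i < l, μ i ≠ μ l) {j : ℕ} (hj : j < l) : P (u j) = 0 := by
  induction j with
  | zero =>
    have heq : (μ l - μ 0) • P (u 0) = 0 := by rw [sub_smul, ← hP, h.zero, map_smul, sub_self]
    exact (smul_eq_zero.1 heq).resolve_left (sub_ne_zero.2 (hμ 0 hj).symm)
  | succ j ih =>
    have heq := h.sub_smul_map_succ hP j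
    rw [ih (by omega), smul_zero] at heq
    exact (smul_eq_zero.1 heq).resolve_left (sub_ne_zero.2 (hμ _ hj).symm)

theorem map_eq_prod_smul (h : IsLadder A μ b u) (hP : ∀ x, P (A x) = μ l • P x) {j : ℕ}
    (hlj : l ≤ j) (hμ : ∀ i ∈ Finset.Ioc l j, μ i ≠ μ l) :
    P (u j) = (∏ i ∈ Finset.Ico l j, b i / (μ l - μ (i + 1))) • P (u l) := by
  induction j, hlj using Nat.le_induction with
  | base => simp
  | succ j hlj ih =>
    have hne : μ l - μ (j + 1) ≠ 0 :=
      sub_ne_zero.2 (hμ _ (Finset.mem_Ioc.2 ⟨by omega, le_rfl⟩)).symm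
    have hih := ih fun i hi => hμ i (Finset.Ioc_subset_Ioc_right j.le_succ hi)
    rw [Finset.prod_Ico_succ_top hlj, mul_comm, mul_smul, ← hih, div_eq_inv_mul, mul_smul,
      ← h.sub_smul_map_succ hP, inv_smul_smul₀ hne]

theorem map_eq_map_ladderEigenvector (h : IsLadder A μ b u) (hP : ∀ x, P (A x) = μ l • P x)
    (hμ : ∀ i < l, μ i ≠ μ l) : P (u l) = P (ladderEigenvector μ b u l) := by
  rw [ladderEigenvector, Finset.sum_range_succ, map_add, map_sum, Finset.sum_eq_zero, zero_add,
    ladderCoeff_self, one_smul]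
  intro j hj
  rw [map_smul, h.map_eq_zero_of_lt hP hμ (Finset.mem_range.1 hj), smul_zero]

end Map

theorem sum_proj_eq_self (h : IsLadder A μ b u) {m : ℕ} (hμ : Set.InjOn μ (Set.Iic m))
    {P : ℕ → Module.End K V} (hP : ∀ l x, P l (A x) = μ l • P l x)
    (hfix : ∀ l x, A x = μ l • x → P l x = x) {j : ℕ} (hj : j ≤ m) :
    ∑ l ∈ Finset.range (m + 1), P l (u j) = u j := by
  induction j using Nat.strong_induction_on with
  | _ j ih =>
    set e := ladderEigenvector μ b u j with he
    have hAe : A e = μ j • e :=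
      h.map_ladderEigenvector fun i hi => hμ.ne (Set.mem_Iic.2 (by omega)) hj hi.ne
    have hsplit : u j = e - ∑ i ∈ Finset.range j, ladderCoeff μ b j i • u i := by
      rw [he, ladderEigenvector, Finset.sum_range_succ, ladderCoeff_self, one_smul,
        add_sub_cancel_left]
    have hsum_e : ∑ l ∈ Finset.range (m + 1), P l e = e := by
      rw [Finset.sum_eq_single_of_mem j (Finset.mem_range_succ_iff.2 hj), hfix j e hAe]
      intro l hl hlj
      have heq : (μ l - μ j) • P l e = 0 := by rw [sub_smul, ← hP, hAe, map_smul, sub_self]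
      exact (smul_eq_zero.1 heq).resolve_left
        (sub_ne_zero.2 (hμ.ne (Finset.mem_range_succ_iff.1 hl) hj hlj))
    rw [hsplit]
    simp only [map_sub, map_sum, map_smul, Finset.sum_sub_distrib, hsum_e]
    rw [Finset.sum_comm]
    simp only [← Finset.smul_sum]
    congr 1
    refine Finset.sum_congr rfl fun i hi => ?_
    have hij := Finset.mem_range.1 hi
    rw [ih i hij (hij.le.trans hj)]

end IsLadder

end Ladder

section SymmetricOperator

open Module.End

variable {𝕜 E : Type*} [RCLike 𝕜] [NormedAddCommGroup E] [InnerProductSpace 𝕜 E]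

theorem starProjection_eigenspace_map {A : E →ₗ[𝕜] E} (hA : A.IsSymmetric) (μ : 𝕜)
    [(eigenspace A μ).HasOrthogonalProjection] (x : E) :
    (eigenspace A μ).starProjection (A x) = μ • (eigenspace A μ).starProjection x := by
  have hproj : A ((eigenspace A μ).starProjection x) = μ • (eigenspace A μ).starProjection x :=
    mem_eigenspace_iff.1 (Submodule.starProjection_apply_mem _ x)
  refine Submodule.eq_starProjection_of_mem_orthogonal
    (Submodule.smul_mem _ _ (Submodule.starProjection_apply_mem _ x)) ?_
  rw [← hproj, ← map_sub]
  exact hA.invariant_orthogonalComplement_eigenspace μ _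
    (Submodule.sub_starProjection_mem_orthogonal x)

theorem inner_self_starProjection (K : Submodule 𝕜 E) [K.HasOrthogonalProjection] (x : E) :
    inner 𝕜 x (K.starProjection x) = ((‖K.starProjection x‖ : 𝕜)) ^ 2 := by
  rw [← inner_self_eq_norm_sq_to_K, Submodule.inner_starProjection_left_eq_right,
    Submodule.starProjection_eq_self_iff.2 (Submodule.starProjection_apply_mem _ _)]

theorem norm_sq_sum_smul_of_pairwise_inner_eq_zero {ι : Type*} {s : Finset ι} {x : ι → E}
    (hx : (s : Set ι).Pairwise fun i j => inner 𝕜 (x i) (x j) = 0) (c : ι → 𝕜) :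
    ‖∑ i ∈ s, c i • x i‖ ^ 2 = ∑ i ∈ s, ‖c i‖ ^ 2 * ‖x i‖ ^ 2 := by
  classical
  induction s using Finset.induction_on with
  | empty => simp
  | insert i s hi ih =>
    have horth : inner 𝕜 (c i • x i) (∑ j ∈ s, c j • x j) = 0 := by
      refine (inner_sum _ _ _).trans (Finset.sum_eq_zero fun j hj => ?_)
      rw [inner_smul_left, inner_smul_right, hx (by simp) (by simp [hj]) (by grind), mul_zero,
        mul_zero]
    rw [Finset.sum_insert hi, Finset.sum_insert hi, sq,
      norm_add_sq_eq_norm_sq_add_norm_sq_of_inner_eq_zero _ _ horth, ← sq, ← sq, norm_smul,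
      mul_pow, ih (hx.mono (by simp))]

end SymmetricOperator

section Exchange

variable {α : Type*} [DecidableEq α] {s t : Finset α} {x y : α}

/-- The set obtained from `s` by exchanging `x ∈ s` for `y ∉ s`. The neighbours of a vertex `s` of
a Johnson graph are its exchanges. -/
def exchange (s : Finset α) (x y : α) : Finset α := insert y (s.erase x)

theorem card_exchange (hx : x ∈ s) (hy : y ∉ s) : (exchange s x y).card = s.card := by
  rw [exchange, Finset.card_insert_of_notMem fun h => hy (Finset.mem_of_mem_erase h),
    Finset.card_erase_add_one hx]

theorem inter_exchange (hy : y ∉ s) : s ∩ exchange s x y = s.erase x := by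
  rw [exchange, Finset.inter_insert_of_notMem hy, Finset.inter_eq_right.2 (Finset.erase_subset x s)]

theorem injOn_exchange :
    Set.InjOn (fun z : α × α => exchange s z.1 z.2) {z | z.1 ∈ s ∧ z.2 ∉ s} := by
  rintro ⟨x, y⟩ ⟨hx, hy⟩ ⟨x', y'⟩ ⟨_, hy'⟩ h
  have hx_mem : x ∈ exchange s x y ↔ x ∈ exchange s x' y' := Finset.ext_iff.1 h x
  have hy_mem : y ∈ exchange s x y ↔ y ∈ exchange s x' y' := Finset.ext_iff.1 h y
  simp only [exchange, Finset.mem_insert, Finset.mem_erase] at hx_mem hy_mem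
  have hxx' : x = x' := by grind
  have hyy' : y = y' := by grind
  rw [hxx', hyy']

theorem exists_exchange_eq (hcard : t.card = s.card) (hinter : (s ∩ t).card + 1 = s.card) :
    ∃ x ∈ s, ∃ y ∉ s, exchange s x y = t := by
  have hst := Finset.card_sdiff_add_card_inter s t
  have hts := Finset.card_sdiff_add_card_inter t s
  rw [Finset.inter_comm] at hts
  obtain ⟨x, hx⟩ := Finset.card_eq_one.1 (by omega : (s \ t).card = 1)
  obtain ⟨y, hy⟩ := Finset.card_eq_one.1 (by omega : (t \ s).card = 1)
  have hx_iff (a : α) : a ∈ s ∧ a ∉ t ↔ a = x := by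
    rw [← Finset.mem_sdiff, hx, Finset.mem_singleton]
  have hy_iff (a : α) : a ∈ t ∧ a ∉ s ↔ a = y := by
    rw [← Finset.mem_sdiff, hy, Finset.mem_singleton]
  refine ⟨x, ((hx_iff x).2 rfl).1, y, ((hy_iff y).2 rfl).2, ?_⟩
  ext a
  have hxa := hx_iff a
  have hya := hy_iff a
  simp only [exchange, Finset.mem_insert, Finset.mem_erase]
  tauto

theorem card_exchange_inter (hx : x ∈ s) (hy : y ∉ s) :
    (exchange s x y ∩ t).card =
      (s ∩ t).card - (if x ∈ t then 1 else 0) + (if y ∈ t then 1 else 0) := by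
  have herase : (s.erase x ∩ t).card = (s ∩ t).card - (if x ∈ t then 1 else 0) := by
    rw [Finset.erase_inter]
    split_ifs with hxt
    · exact Finset.card_erase_of_mem (Finset.mem_inter.2 ⟨hx, hxt⟩)
    · rw [Finset.erase_eq_of_notMem fun h => hxt (Finset.mem_inter.1 h).2, Nat.sub_zero]
  rw [exchange, ← herase]
  split_ifs with hyt
  · rw [Finset.insert_inter_of_mem hyt, Finset.card_insert_of_notMem (by simp [hy])]
  · rw [Finset.insert_inter_of_notMem hyt, add_zero]

theorem cast_card_sdiff_eq_sub {R : Type*} [AddCommGroupWithOne R] (s t : Finset α) :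
    ((s \ t).card : R) = s.card - (s ∩ t).card := by
  rw [← Finset.card_sdiff_add_card_inter s t, Nat.cast_add, add_sub_cancel_right]

theorem sum_ite_mem_eq {R : Type*} [Semiring R] (s t : Finset α) (a b : R) :
    ∑ x ∈ s, (if x ∈ t then a else b) = (s ∩ t).card * a + (s \ t).card * b := by
  rw [Finset.sum_ite, Finset.sum_const, Finset.sum_const, nsmul_eq_mul, nsmul_eq_mul,
    Finset.filter_mem_eq_inter, Finset.filter_notMem_eq_sdiff]

end Exchange

section Adjacency

variable {n k : ℕ}

theorem sum_neighborFinset {M : Type*} [AddCommMonoid M] (v : Vertex n k)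
    (f : Finset (Fin n) → M) :
    ∑ u ∈ (johnsonGraph n k).neighborFinset v, f u.1 =
      ∑ x ∈ v.1, ∑ y ∈ v.1ᶜ, f (exchange v.1 x y) := by
  rw [← Finset.sum_product']
  symm
  have hmem {z : Fin n × Fin n} (hz : z ∈ v.1 ×ˢ v.1ᶜ) : z.1 ∈ v.1 ∧ z.2 ∉ v.1 := by
    simpa using hz
  refine Finset.sum_bij
    (fun z hz => ⟨exchange v.1 z.1 z.2, (card_exchange (hmem hz).1 (hmem hz).2).trans v.2⟩)
    (fun z hz => ?_) (fun z hz z' hz' h => injOn_exchange (hmem hz) (hmem hz')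
      (congrArg Subtype.val h))
    (fun u hu => ?_) fun _ _ => rfl
  · rw [SimpleGraph.mem_neighborFinset]
    change (v.1 ∩ exchange v.1 z.1 z.2).card + 1 = k
    rw [inter_exchange (hmem hz).2, Finset.card_erase_add_one (hmem hz).1, v.2]
  · obtain ⟨x, hx, y, hy, hxy⟩ := exists_exchange_eq (u.2.trans v.2.symm)
      (((SimpleGraph.mem_neighborFinset _ _ _).1 hu).trans v.2.symm)
    exact ⟨(x, y), by simp [hx, hy], Subtype.ext hxy⟩

theorem adjOp_apply (x : State n k) (v : Vertex n k) :
    adjOp n k x v = ∑ u ∈ (johnsonGraph n k).neighborFinset v, x u := by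
  change (((johnsonGraph n k).adjMatrix ℂ).mulVec (WithLp.ofLp x)) v = _
  rw [SimpleGraph.adjMatrix_mulVec_apply]

theorem isSymmetric_adjOp (n k : ℕ) : (adjOp n k).toLinearMap.IsSymmetric := by
  rw [adjOp, Matrix.coe_toEuclideanCLM_eq_toEuclideanLin, Matrix.isSymmetric_toEuclideanLin_iff]
  ext
  simp [SimpleGraph.adjMatrix_apply, SimpleGraph.adj_comm]

theorem sum_neighborFinset_card_inter {R : Type*} [CommRing R] (v : Vertex n k)
    (T : Finset (Fin n)) (g : ℕ → R) {i : ℕ} (hi : (v.1 ∩ T).card = i) :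
    ∑ u ∈ (johnsonGraph n k).neighborFinset v, g (u.1 ∩ T).card =
      i * ((T.card - i) * g i + (n - k - T.card + i) * g (i - 1)) +
        (k - i) * ((T.card - i) * g (i + 1) + (n - k - T.card + i) * g i) := by
  have hv_sdiff : ((v.1 \ T).card : R) = k - i := by rw [cast_card_sdiff_eq_sub, v.2, hi]
  have hT_sdiff : ((v.1ᶜ ∩ T).card : R) = T.card - i := by
    rw [Finset.inter_comm, ← Finset.sdiff_eq_inter_compl, cast_card_sdiff_eq_sub,
      Finset.inter_comm, hi]
  have hcompl : ((v.1ᶜ \ T).card : R) = n - k - T.card + i := by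
    have hn := congrArg (Nat.cast : ℕ → R) (Finset.card_add_card_compl v.1)
    rw [Nat.cast_add, v.2, Fintype.card_fin] at hn
    rw [cast_card_sdiff_eq_sub, hT_sdiff]
    linear_combination hn
  have hexchange : ∀ x ∈ v.1, ∀ y ∈ v.1ᶜ, g (exchange v.1 x y ∩ T).card =
      if x ∈ T then (if y ∈ T then g i else g (i - 1))
        else (if y ∈ T then g (i + 1) else g i) := by
    intro x hx y hy
    rw [card_exchange_inter hx (Finset.mem_compl.1 hy), hi]
    have hpos : x ∈ T → 0 < i := fun hxT =>
      hi ▸ Finset.card_pos.2 ⟨x, Finset.mem_inter.2 ⟨hx, hxT⟩⟩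
    split_ifs <;> grind
  have hinner (x : Fin n) : (∑ y ∈ v.1ᶜ, if x ∈ T then (if y ∈ T then g i else g (i - 1))
        else (if y ∈ T then g (i + 1) else g i)) =
      if x ∈ T then (T.card - i) * g i + (n - k - T.card + i) * g (i - 1)
        else (T.card - i) * g (i + 1) + (n - k - T.card + i) * g i := by
    split_ifs <;> rw [sum_ite_mem_eq, hT_sdiff, hcompl]
  rw [sum_neighborFinset v fun s => g (s ∩ T).card,
    Finset.sum_congr rfl fun x hx => Finset.sum_congr rfl (hexchange x hx)]
  simp only [hinner]
  rw [sum_ite_mem_eq, hv_sdiff, hi]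

end Adjacency

section SubsetCount

theorem sub_mul_choose {R : Type*} [CommRing R] (i j : ℕ) :
    ((i : R) - j) * i.choose j = (j + 1) * i.choose (j + 1) := by
  rcases le_or_gt j i with h | h
  · have hchoose := congrArg (Nat.cast : ℕ → R) (Nat.choose_succ_right_eq i j)
    push_cast [Nat.cast_sub h] at hchoose
    linear_combination -hchoose
  · simp [Nat.choose_eq_zero_of_lt h, Nat.choose_eq_zero_of_lt (h.trans j.lt_succ_self)]

theorem mul_choose_sub_one {R : Type*} [CommRing R] (i j : ℕ) :
    (i : R) * (i - 1).choose j = (i - j) * i.choose j := by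
  rcases i with _ | i
  · rcases j with _ | j <;> simp
  · have hsucc := congrArg (Nat.cast : ℕ → R) (Nat.add_one_mul_choose_eq i j)
    push_cast at hsucc
    rw [Nat.add_sub_cancel, sub_mul_choose (i + 1) j]
    push_cast
    linear_combination hsucc

variable {n k : ℕ}

/-- The vector whose component at `v` counts the `j`-subsets of `v ∩ T`. -/
def subsetCount (k : ℕ) (T : Finset (Fin n)) (j : ℕ) : State n k :=
  WithLp.toLp 2 fun v => ((v.1 ∩ T).card.choose j : ℂ)

theorem subsetCount_apply (T : Finset (Fin n)) (j : ℕ) (v : Vertex n k) :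
    subsetCount k T j v = ((v.1 ∩ T).card.choose j : ℂ) := rfl

theorem subsetCount_zero (T : Finset (Fin n)) : subsetCount k T 0 = ∑ v : Vertex n k, ket v := by
  ext v
  simp [subsetCount_apply, ket]

theorem subsetCount_self (w : Vertex n k) : subsetCount k w.1 k = ket w := by
  ext v
  rw [subsetCount_apply, ket, PiLp.single_apply]
  split_ifs with hvw
  · rw [hvw, Finset.inter_self, w.2, Nat.choose_self, Nat.cast_one]
  · have hlt : (v.1 ∩ w.1).card < k := by
      refine (Finset.card_lt_card (Finset.inter_subset_left.ssubset_of_ne fun h => hvw ?_)).trans_eq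
        v.2
      exact Subtype.ext (Finset.eq_of_subset_of_card_le (Finset.inter_eq_left.1 h)
        (w.2.trans v.2.symm).le)
    rw [Nat.choose_eq_zero_of_lt hlt, Nat.cast_zero]

theorem isLadder_subsetCount (n k : ℕ) (T : Finset (Fin n)) :
    IsLadder (adjOp n k).toLinearMap (fun j => (eigenval n k j : ℂ))
      (fun j => ((k : ℂ) - j) * (T.card - j)) (subsetCount k T) where
  zero := by
    ext v
    rw [ContinuousLinearMap.coe_coe, adjOp_apply]
    simp only [subsetCount_apply, PiLp.smul_apply, smul_eq_mul]
    rw [sum_neighborFinset_card_inter v T (fun m => (m.choose 0 : ℂ)) rfl]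
    simp only [Nat.choose_zero_right, eigenval]
    push_cast
    ring
  succ j := by
    ext v
    rw [ContinuousLinearMap.coe_coe, adjOp_apply]
    simp only [subsetCount_apply, PiLp.add_apply, PiLp.smul_apply, smul_eq_mul]
    rw [sum_neighborFinset_card_inter v T (fun m => (m.choose (j + 1) : ℂ)) rfl]
    generalize (v.1 ∩ T).card = i
    have hsub := mul_choose_sub_one (R := ℂ) i (j + 1)
    rw [Nat.choose_succ_succ i j]
    simp only [eigenval]
    push_cast at hsub ⊢
    linear_combination ((n : ℂ) - k - T.card + i) * hsub +
      (i + j - (k : ℂ) - T.card) * sub_mul_choose (R := ℂ) i j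

end SubsetCount

section Factorial

variable {F : Type*} [Field F] [CharZero F]

theorem prod_range_natCast_sub_eq_div {N m : ℕ} (h : m ≤ N) :
    ∏ i ∈ Finset.range m, ((N : F) - i) = (N.factorial : F) / (N - m).factorial := by
  rw [Finset.prod_range_natCast_sub, eq_div_iff (by exact_mod_cast Nat.factorial_ne_zero _),
    ← Nat.descFactorial_eq_prod_range, ← Nat.cast_mul, mul_comm, Nat.factorial_mul_descFactorial h]

theorem prod_Ico_sub_sq_div {n k l : ℕ} (hl : l ≤ k) (hn : 2 * k ≤ n) :
    ∏ i ∈ Finset.Ico l k, ((k : F) - i) ^ 2 / ((i + 1 - l) * (n - l - i)) =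
      ((k - l).factorial : F) * (n - k - l).factorial / (n - 2 * l).factorial := by
  have hfac (m : ℕ) : (m.factorial : F) ≠ 0 := by exact_mod_cast m.factorial_ne_zero
  have hup : ∏ i ∈ Finset.range (k - l), (((l + i : ℕ) : F) + 1 - l) = (k - l).factorial := by
    rw [← Finset.prod_range_add_one_eq_factorial, Nat.cast_prod]
    refine Finset.prod_congr rfl fun i _ => ?_
    push_cast
    ring
  have hk : ∏ i ∈ Finset.range (k - l), ((k : F) - (l + i : ℕ)) = (k - l).factorial := by
    rw [← div_one ((k - l).factorial : F), ← Nat.cast_one, ← Nat.factorial_zero, ← Nat.sub_self,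
      ← prod_range_natCast_sub_eq_div le_rfl]
    simp only [Nat.cast_sub hl, Nat.cast_add, sub_sub]
  have hdown : ∏ i ∈ Finset.range (k - l), ((n : F) - l - (l + i : ℕ)) =
      ((n - 2 * l).factorial : F) / (n - k - l).factorial := by
    rw [show n - k - l = n - 2 * l - (k - l) by omega, ← prod_range_natCast_sub_eq_div (by omega)]
    refine Finset.prod_congr rfl fun i _ => ?_
    push_cast [Nat.cast_sub (by omega : 2 * l ≤ n)]
    ring
  rw [Finset.prod_Ico_eq_prod_range, Finset.prod_div_distrib, Finset.prod_pow,
    Finset.prod_mul_distrib, hup, hk, hdown]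
  field_simp [hfac]

theorem prod_range_sub_mul_sub_div {n k l : ℕ} (hl : l ≤ k) (hn : 2 * k ≤ n) :
    ∏ i ∈ Finset.range l, ((k : F) - i) * (n - k - i) / ((l - i) * (n + 1 - l - i)) =
      ((k.factorial : F) * (n - k).factorial * (n + 1 - 2 * l).factorial) /
        ((k - l).factorial * (n - k - l).factorial * (l.factorial * (n + 1 - l).factorial)) := by
  have hcompl : ∏ i ∈ Finset.range l, ((n : F) - k - i) =
      ((n - k).factorial : F) / (n - k - l).factorial := by
    rw [← prod_range_natCast_sub_eq_div (by omega), Nat.cast_sub (by omega)]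
  have hl_self : ∏ i ∈ Finset.range l, ((l : F) - i) = l.factorial := by
    simpa using prod_range_natCast_sub_eq_div (F := F) (le_refl l)
  have hgap : ∏ i ∈ Finset.range l, ((n : F) + 1 - l - i) =
      ((n + 1 - l).factorial : F) / (n + 1 - 2 * l).factorial := by
    rw [show n + 1 - 2 * l = n + 1 - l - l by omega, ← prod_range_natCast_sub_eq_div (by omega),
      Nat.cast_sub (by omega), Nat.cast_succ]
  have hfac (m : ℕ) : (m.factorial : F) ≠ 0 := by exact_mod_cast m.factorial_ne_zero
  rw [Finset.prod_div_distrib, Finset.prod_mul_distrib, Finset.prod_mul_distrib,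
    prod_range_natCast_sub_eq_div hl, hcompl, hl_self, hgap]
  field_simp [hfac]

theorem choose_sub_eq_sum {R : Type*} [CommRing R] {k x : ℕ} (hx : x ≤ k) (l : ℕ) :
    ((k - x).choose l : R) =
      ∑ i ∈ Finset.range (l + 1), (-1 : R) ^ i * (k - i).choose (l - i) * x.choose i := by
  induction x generalizing k l with
  | zero => simp [Finset.sum_range_succ']
  | succ x ih =>
    obtain ⟨m, rfl⟩ := Nat.exists_eq_add_of_le' (Nat.one_le_of_lt hx)
    have hxm : x ≤ m := by omega
    rcases l with _ | l
    · simp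
    have hpascal : ((m + 1 - x).choose (l + 1) : R) =
        (m - x).choose l + (m - x).choose (l + 1) := by
      rw [Nat.succ_sub hxm, Nat.choose_succ_succ, Nat.cast_add]
    have hsplit : ∑ i ∈ Finset.range (l + 2),
          (-1 : R) ^ i * (m + 1 - i).choose (l + 1 - i) * (x + 1).choose i =
        ∑ i ∈ Finset.range (l + 2), (-1 : R) ^ i * (m + 1 - i).choose (l + 1 - i) * x.choose i -
          ∑ i ∈ Finset.range (l + 1), (-1 : R) ^ i * (m - i).choose (l - i) * x.choose i := by
      rw [Finset.sum_range_succ', Finset.sum_range_succ' _ (l + 1), add_sub_right_comm,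
        ← Finset.sum_sub_distrib]
      congr 1
      · refine Finset.sum_congr rfl fun i _ => ?_
        rw [Nat.add_sub_add_right, Nat.add_sub_add_right, Nat.choose_succ_succ x i]
        push_cast
        ring
      · simp
    rw [hsplit, ← ih (by omega), ← ih hxm, hpascal, Nat.add_sub_add_right, add_sub_cancel_left]

end Factorial

section Spectrum

variable {n k l : ℕ}

theorem eigenval_sub (n k l j : ℕ) :
    eigenval n k l - eigenval n k j = ((j : ℝ) - l) * (n + 1 - l - j) := by
  simp only [eigenval]
  ring

theorem strictAntiOn_eigenval (hn : 2 * k ≤ n) : StrictAntiOn (eigenval n k) (Set.Iic k) := by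
  intro l hl j hj hlj
  have hlj' : (l : ℝ) < j := by exact_mod_cast hlj
  have hsum : (l : ℝ) + j ≤ n := by
    have := Set.mem_Iic.1 hl
    have := Set.mem_Iic.1 hj
    exact_mod_cast (by omega : l + j ≤ n)
  rw [← sub_pos, eigenval_sub]
  exact mul_pos (by linarith) (by linarith)

theorem injOn_ofReal_eigenval (hn : 2 * k ≤ n) :
    Set.InjOn (fun l => (eigenval n k l : ℂ)) (Set.Iic k) :=
  Complex.ofReal_injective.comp_injOn (strictAntiOn_eigenval hn).injOn

theorem eigenProj_mem_eigenspace (n k l : ℕ) (x : State n k) :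
    eigenProj n k l x ∈ Module.End.eigenspace (adjOp n k).toLinearMap (eigenval n k l : ℂ) :=
  Submodule.starProjection_apply_mem _ _

theorem adjOp_eigenProj (n k l : ℕ) (x : State n k) :
    adjOp n k (eigenProj n k l x) = (eigenval n k l : ℂ) • eigenProj n k l x :=
  Module.End.mem_eigenspace_iff.1 (eigenProj_mem_eigenspace n k l x)

theorem eigenProj_adjOp (n k l : ℕ) (x : State n k) :
    eigenProj n k l (adjOp n k x) = (eigenval n k l : ℂ) • eigenProj n k l x :=
  starProjection_eigenspace_map (isSymmetric_adjOp n k) _ x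

theorem eigenProj_eq_self {x : State n k} (hx : adjOp n k x = (eigenval n k l : ℂ) • x) :
    eigenProj n k l x = x :=
  Submodule.starProjection_eq_self_iff.2 (Module.End.mem_eigenspace_iff.2 hx)

theorem inner_eigenProj_eigenProj {j : ℕ} (h : eigenval n k l ≠ eigenval n k j)
    (x y : State n k) : inner ℂ (eigenProj n k l x) (eigenProj n k j y) = 0 :=
  (isSymmetric_adjOp n k).orthogonalFamily_eigenspaces (Complex.ofReal_injective.ne h)
    ⟨_, eigenProj_mem_eigenspace n k l x⟩ ⟨_, eigenProj_mem_eigenspace n k j y⟩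

theorem sum_eigenProj_ket (hn : 2 * k ≤ n) (w : Vertex n k) :
    ∑ l ∈ Finset.range (k + 1), eigenProj n k l (ket w) = ket w := by
  have hsum := (isLadder_subsetCount n k w.1).sum_proj_eq_self (injOn_ofReal_eigenval hn)
    (P := fun l => (eigenProj n k l).toLinearMap) (fun l => eigenProj_adjOp n k l)
    (fun _ _ => eigenProj_eq_self) le_rfl
  rwa [subsetCount_self] at hsum

theorem eigenProj_subsetCount_of_lt (hn : 2 * k ≤ n) (hl : l ≤ k) (T : Finset (Fin n)) {j : ℕ}
    (hj : j < l) : eigenProj n k l (subsetCount k T j) = 0 :=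
  (isLadder_subsetCount n k T).map_eq_zero_of_lt (P := (eigenProj n k l).toLinearMap)
    (eigenProj_adjOp n k l) (fun i hi => (injOn_ofReal_eigenval hn).ne
      (Set.mem_Iic.2 (by omega)) hl hi.ne) hj

theorem eigenProj_ket (hn : 2 * k ≤ n) (hl : l ≤ k) (w : Vertex n k) :
    eigenProj n k l (ket w) =
      (((k - l).factorial : ℂ) * (n - k - l).factorial / (n - 2 * l).factorial) •
        eigenProj n k l (subsetCount k w.1 l) := by
  have hclimb := (isLadder_subsetCount n k w.1).map_eq_prod_smul
    (P := (eigenProj n k l).toLinearMap) (eigenProj_adjOp n k l) hl fun i hi => by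
      obtain ⟨hli, hik⟩ := Finset.mem_Ioc.1 hi
      exact (injOn_ofReal_eigenval hn).ne hik hl hli.ne'
  rw [subsetCount_self, ContinuousLinearMap.coe_coe] at hclimb
  rw [hclimb, ← prod_Ico_sub_sq_div hl hn, w.2]
  congr 1
  refine Finset.prod_congr rfl fun i _ => ?_
  rw [← Complex.ofReal_sub, eigenval_sub]
  push_cast
  ring_nf

theorem subsetCount_compl (T : Finset (Fin n)) (l : ℕ) :
    subsetCount k Tᶜ l = ∑ i ∈ Finset.range (l + 1),
      ((-1) ^ i * ((k - i).choose (l - i) : ℂ)) • subsetCount k T i := by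
  ext v
  have hcard : (v.1 ∩ Tᶜ).card = k - (v.1 ∩ T).card := by
    rw [← Finset.sdiff_eq_inter_compl, Finset.card_sdiff, v.2, Finset.inter_comm]
  have hle : (v.1 ∩ T).card ≤ k := (Finset.card_le_card Finset.inter_subset_left).trans_eq v.2
  simp [subsetCount_apply, hcard, choose_sub_eq_sum hle]

theorem eigenProj_subsetCount_compl (hn : 2 * k ≤ n) (hl : l ≤ k) (T : Finset (Fin n)) :
    eigenProj n k l (subsetCount k Tᶜ l) = (-1 : ℂ) ^ l • eigenProj n k l (subsetCount k T l) := by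
  rw [subsetCount_compl, Finset.sum_range_succ, map_add, map_sum, Finset.sum_eq_zero fun i hi => ?_]
  · simp
  · rw [map_smul, eigenProj_subsetCount_of_lt hn hl T (Finset.mem_range.1 hi), smul_zero]

theorem eigenProj_subsetCount_compl_apply_self (hn : 2 * k ≤ n) (hl : l ≤ k) (w : Vertex n k) :
    (eigenProj n k l (subsetCount k w.1ᶜ l)) w =
      (-1 : ℂ) ^ l * ∏ i ∈ Finset.range l, ((k : ℂ) - i) * (n - k - i) /
        ((l - i) * (n + 1 - l - i)) := by
  have hladder := isLadder_subsetCount n k w.1ᶜ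
  have hne (i : ℕ) (hi : i < l) : (eigenval n k i : ℂ) ≠ eigenval n k l :=
    (injOn_ofReal_eigenval hn).ne (Set.mem_Iic.2 (by omega)) hl hi.ne
  have hproj := hladder.map_eq_map_ladderEigenvector (P := (eigenProj n k l).toLinearMap)
    (eigenProj_adjOp n k l) hne
  simp only [ContinuousLinearMap.coe_coe] at hproj
  have hcard : ((w.1ᶜ).card : ℂ) = n - k := by
    rw [Finset.card_compl, w.2, Fintype.card_fin, Nat.cast_sub (by omega)]
  have hcount (j : ℕ) : subsetCount k w.1ᶜ j w = if j = 0 then 1 else 0 := by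
    rw [subsetCount_apply, Finset.inter_compl, Finset.card_empty]
    rcases j with _ | j <;> simp
  -- As `w ∩ wᶜ = ∅`, only the lowest rung contributes to the eigenvector at `w`.
  rw [hproj, eigenProj_eq_self (hladder.map_ladderEigenvector hne), ladderEigenvector]
  simp only [WithLp.ofLp_sum, WithLp.ofLp_smul, Finset.sum_apply, Pi.smul_apply, hcount,
    smul_eq_mul, mul_ite, mul_one, mul_zero, Finset.sum_ite_eq', Finset.mem_range,
    Nat.zero_lt_succ, if_true]
  rw [ladderCoeff, Nat.Ico_zero_eq_range, hcard, ← Finset.card_range l, ← Finset.prod_const,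
    Finset.card_range, ← Finset.prod_mul_distrib]
  refine Finset.prod_congr rfl fun i _ => ?_
  rw [← Complex.ofReal_sub, eigenval_sub, ← neg_sub (l : ℝ) i, neg_mul, Complex.ofReal_neg, div_neg]
  push_cast
  ring

theorem inner_ket (v : Vertex n k) (x : State n k) : inner ℂ (ket v) x = x v := by
  simp [ket, EuclideanSpace.inner_single_left]

theorem norm_eigenProj_ket_sq (hn : 2 * k ≤ n) (hl : l ≤ k) (w : Vertex n k) :
    ‖eigenProj n k l (ket w)‖ ^ 2 =
      (k.factorial : ℝ) * (n - k).factorial * (n + 1 - 2 * l) /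
        (l.factorial * (n + 1 - l).factorial) := by
  have hfac (m : ℕ) : (m.factorial : ℂ) ≠ 0 := by exact_mod_cast m.factorial_ne_zero
  have hgap : ((n + 1 - 2 * l).factorial : ℂ) = (n + 1 - 2 * l) * (n - 2 * l).factorial := by
    rw [Nat.succ_sub (by omega : 2 * l ≤ n), Nat.factorial_succ, Nat.cast_mul]
    push_cast [Nat.cast_sub (by omega : 2 * l ≤ n)]
    ring
  have hself : eigenProj n k l (subsetCount k w.1 l) =
      (-1 : ℂ) ^ l • eigenProj n k l (subsetCount k w.1ᶜ l) := by
    rw [eigenProj_subsetCount_compl hn hl, smul_smul, ← mul_pow, neg_one_mul, neg_neg, one_pow,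
      one_smul]
  have hnorm := inner_self_starProjection
    (Module.End.eigenspace (adjOp n k).toLinearMap (eigenval n k l : ℂ)) (ket w)
  change inner ℂ (ket w) (eigenProj n k l (ket w)) = (‖eigenProj n k l (ket w)‖ : ℂ) ^ 2 at hnorm
  rw [inner_ket, eigenProj_ket hn hl, hself, PiLp.smul_apply, PiLp.smul_apply,
    eigenProj_subsetCount_compl_apply_self hn hl, prod_range_sub_mul_sub_div hl hn, hgap,
    smul_eq_mul, smul_eq_mul, ← mul_assoc ((-1 : ℂ) ^ l), ← mul_pow, neg_one_mul, neg_neg, one_pow,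
    one_mul, ← hself, ← eigenProj_ket hn hl] at hnorm
  apply Complex.ofReal_injective
  push_cast
  rw [← hnorm]
  field_simp [hfac]

theorem eigenProj_zero_ket (hn : 2 * k ≤ n) (w : Vertex n k) :
    eigenProj n k 0 (ket w) = ((1 / √(n.choose k : ℝ) : ℝ) : ℂ) • uniformState n k := by
  have hfix : eigenProj n k 0 (subsetCount k w.1 0) = subsetCount k w.1 0 :=
    eigenProj_eq_self (isLadder_subsetCount n k w.1).zero
  have hchoose : ((1 / √(n.choose k : ℝ) : ℝ) : ℂ) * ((1 / √(n.choose k : ℝ) : ℝ) : ℂ) =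
      (k.factorial : ℂ) * (n - k).factorial / n.factorial := by
    rw [← Complex.ofReal_mul, one_div_mul_one_div, Real.mul_self_sqrt (Nat.cast_nonneg _),
      Nat.cast_choose ℝ (by omega : k ≤ n)]
    push_cast
    rw [one_div_div]
  rw [eigenProj_ket hn k.zero_le, hfix, subsetCount_zero, uniformState, smul_smul, hchoose]
  simp only [Nat.sub_zero, mul_zero]

end Spectrum

section Evolution

variable {V : Type*} [NormedAddCommGroup V] [InnerProductSpace ℂ V]

section Duhamel

variable [CompleteSpace V]

theorem exp_mem_unitary_of_mem_skewAdjoint {G : V →L[ℂ] V}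
    (hG : G ∈ skewAdjoint (V →L[ℂ] V)) : NormedSpace.exp G ∈ unitary (V →L[ℂ] V) := by
  let _ : NormedAlgebra ℚ (V →L[ℂ] V) := NormedAlgebra.restrictScalars ℚ ℂ (V →L[ℂ] V)
  exact NormedSpace.exp_mem_unitary_of_mem_skewAdjoint hG

theorem norm_exp_smul_apply_of_mem_skewAdjoint {G : V →L[ℂ] V}
    (hG : G ∈ skewAdjoint (V →L[ℂ] V)) (t : ℝ) (x : V) : ‖NormedSpace.exp (t • G) x‖ = ‖x‖ :=
  ContinuousLinearMap.norm_map_of_mem_unitary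
    (exp_mem_unitary_of_mem_skewAdjoint (skewAdjoint.smul_mem t hG)) x

/-- Duhamel: `t ↦ e^{(T-t)G} φ(t)` joins `e^{TG} φ(0)` to `φ(T)` at speed `‖φ' - Gφ‖`. -/
theorem norm_exp_smul_apply_sub_le {G : V →L[ℂ] V} (hG : G ∈ skewAdjoint (V →L[ℂ] V))
    {φ φ' : ℝ → V} (hφ : ∀ t, HasDerivAt φ (φ' t) t) {η : ℝ} (hη : ∀ t, ‖φ' t - G (φ t)‖ ≤ η)
    {T : ℝ} (hT : 0 ≤ T) :
    ‖NormedSpace.exp (T • G) (φ 0) - φ T‖ ≤ η * T := by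
  let restrict := ContinuousLinearMap.restrictScalarsL ℂ V V ℝ ℝ
  have hder (t : ℝ) : HasDerivAt (fun t : ℝ => NormedSpace.exp ((T - t) • G) (φ t))
      (NormedSpace.exp ((T - t) • G) (φ' t - G (φ t))) t := by
    have hexp : HasDerivAt (fun t : ℝ => NormedSpace.exp ((T - t) • G))
        (-(NormedSpace.exp ((T - t) • G) * G)) t := by
      have hcomp := (hasDerivAt_exp_smul_const G (T - t)).scomp t ((hasDerivAt_id t).const_sub T)
      rw [neg_smul, one_smul] at hcomp
      exact hcomp
    have happly := (restrict.hasFDerivAt.comp_hasDerivAt t hexp).clm_apply (hφ t)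
    refine happly.congr_deriv ?_
    simp [restrict, map_sub, neg_add_eq_sub]
  have hmain := norm_image_sub_le_of_norm_deriv_le_segment' (a := 0) (b := T)
    (fun t _ => (hder t).hasDerivWithinAt) (C := η)
    (fun t _ => by rw [norm_exp_smul_apply_of_mem_skewAdjoint hG]; exact hη t) T ⟨hT, le_rfl⟩
  rw [norm_sub_rev]
  simpa using hmain

end Duhamel

/-- The rotation `e^{-iEt} (cos(ωt) s + i sin(ωt) b)` of `s` into `b`. It solves the Schrödinger
equation of any `H` with `(H - E) s = -ω b` and `(H - E) b = -ω s`. -/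
def rotation (E ω : ℝ) (s b : V) (t : ℝ) : V :=
  Complex.exp (t * (-E * Complex.I)) •
    (Complex.cos (t * ω) • s + (Complex.I * Complex.sin (t * ω)) • b)

theorem rotation_zero (E ω : ℝ) (s b : V) : rotation E ω s b 0 = s := by
  simp [rotation]

theorem hasDerivAt_rotation (E ω : ℝ) (s b : V) (t : ℝ) :
    HasDerivAt (rotation E ω s b)
      (-(Complex.I * E) • rotation E ω s b t +
        (Complex.I * ω * Complex.exp (t * (-E * Complex.I))) •
          ((Complex.I * Complex.sin (t * ω)) • s + Complex.cos (t * ω) • b)) t := by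
  have hlin (c : ℂ) : HasDerivAt (fun z : ℂ => z * c) c t := hasDerivAt_mul_const c
  have hplane := ((hlin ω).ccos.comp_ofReal.smul_const s).fun_add
    (((hlin ω).csin.const_mul Complex.I).comp_ofReal.smul_const b)
  refine ((hlin (-E * Complex.I)).cexp.comp_ofReal.fun_smul hplane).congr_deriv ?_
  simp only [rotation]
  match_scalars
  · linear_combination (-Complex.exp (t * (-E * Complex.I)) * Complex.sin (t * ω) * ω) *
      Complex.I_sq
  · ring

theorem norm_deriv_rotation_sub_le {H : V →L[ℂ] V} {E ω : ℝ} {s w b : V}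
    (hs : H s = (E : ℂ) • s - (ω : ℂ) • w) (hb : H b = (E : ℂ) • b - (ω : ℂ) • s) (t : ℝ) :
    ‖deriv (rotation E ω s b) t - (-Complex.I • H) (rotation E ω s b t)‖ ≤ |ω| * ‖b - w‖ := by
  have hdefect : deriv (rotation E ω s b) t - (-Complex.I • H) (rotation E ω s b t) =
      (Complex.I * ω * Complex.exp (t * (-E * Complex.I)) * Complex.cos (t * ω)) • (b - w) := by
    rw [(hasDerivAt_rotation E ω s b t).deriv]
    simp only [rotation, _root_.smul_apply, map_smul, map_add, hs, hb]
    module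
  have hexp : ‖Complex.exp (t * (-E * Complex.I))‖ = 1 := by
    rw [← mul_assoc, ← Complex.ofReal_neg, ← Complex.ofReal_mul, Complex.norm_exp_ofReal_mul_I]
  have hcos : ‖Complex.cos (t * ω)‖ ≤ 1 := by
    rw [← Complex.ofReal_mul, ← Complex.ofReal_cos, Complex.norm_real]
    exact Real.abs_cos_le_one _
  rw [hdefect, norm_smul, norm_mul, norm_mul, norm_mul, hexp, Complex.norm_I, Complex.norm_real,
    one_mul, mul_one, Real.norm_eq_abs]
  gcongr
  exact mul_le_of_le_one_right (abs_nonneg ω) hcos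

theorem norm_exp_sub_rotation_le [CompleteSpace V] {H : V →L[ℂ] V} (hH : IsSelfAdjoint H)
    {E ω : ℝ} {s w b : V} (hs : H s = (E : ℂ) • s - (ω : ℂ) • w)
    (hb : H b = (E : ℂ) • b - (ω : ℂ) • s) {T : ℝ} (hT : 0 ≤ T) :
    ‖NormedSpace.exp ((-Complex.I * (T : ℂ)) • H) s - rotation E ω s b T‖ ≤
      |ω| * ‖b - w‖ * T := by
  have hskew : -Complex.I • H ∈ skewAdjoint (V →L[ℂ] V) := by
    simp [skewAdjoint.mem_iff, star_smul, hH.star_eq]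
  have hduhamel := norm_exp_smul_apply_sub_le hskew
    (fun t => (hasDerivAt_rotation E ω s b t).differentiableAt.hasDerivAt)
    (norm_deriv_rotation_sub_le hs hb) hT
  rwa [rotation_zero, show T • (-Complex.I • H) = (-Complex.I * (T : ℂ)) • H by
    rw [← Complex.coe_smul, smul_smul, mul_comm]] at hduhamel

theorem abs_norm_inner_rotation_sub_abs_sin_le {w b : V} (hwb : inner ℂ w b = 1) (E ω : ℝ) (s : V)
    (t : ℝ) :
    |‖inner ℂ w (rotation E ω s b t)‖ - abs (Real.sin (t * ω))| ≤
      |Real.cos (t * ω)| * ‖inner ℂ w s‖ := by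
  have hexp : ‖Complex.exp (t * (-E * Complex.I))‖ = 1 := by
    rw [← mul_assoc, ← Complex.ofReal_neg, ← Complex.ofReal_mul, Complex.norm_exp_ofReal_mul_I]
  have hinner : ‖inner ℂ w (rotation E ω s b t)‖ =
      ‖Complex.I * Real.sin (t * ω) + Real.cos (t * ω) * inner ℂ w s‖ := by
    rw [rotation, inner_smul_right, norm_mul, hexp, one_mul, inner_add_right, inner_smul_right,
      inner_smul_right, hwb, mul_one, add_comm]
    push_cast
    rfl
  have htriangle := abs_norm_sub_norm_le
    (Complex.I * Real.sin (t * ω) + Real.cos (t * ω) * inner ℂ w s)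
    (Complex.I * Real.sin (t * ω))
  rw [add_sub_cancel_left] at htriangle
  simpa [hinner, -Complex.ofReal_cos, -Complex.ofReal_sin, Complex.norm_real] using htriangle

theorem abs_norm_inner_exp_sub_abs_sin_le [CompleteSpace V] {H : V →L[ℂ] V}
    (hH : IsSelfAdjoint H) {E ω : ℝ} {s w b : V} (hs : H s = (E : ℂ) • s - (ω : ℂ) • w)
    (hb : H b = (E : ℂ) • b - (ω : ℂ) • s) (hw : ‖w‖ = 1) (hwb : inner ℂ w b = 1) {T : ℝ}
    (hT : 0 ≤ T) :
    |‖inner ℂ w (NormedSpace.exp ((-Complex.I * (T : ℂ)) • H) s)‖ - abs (Real.sin (T * ω))| ≤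
      |ω| * ‖b - w‖ * T + |Real.cos (T * ω)| * ‖inner ℂ w s‖ := by
  refine (abs_sub_le _ ‖inner ℂ w (rotation E ω s b T)‖ _).trans
    (add_le_add ?_ (abs_norm_inner_rotation_sub_abs_sin_le hwb E ω s T))
  calc _ ≤ ‖inner ℂ w (NormedSpace.exp ((-Complex.I * (T : ℂ)) • H) s - rotation E ω s b T)‖ := by
        rw [inner_sub_right]
        exact abs_norm_sub_norm_le _ _
    _ ≤ ‖w‖ * ‖NormedSpace.exp ((-Complex.I * (T : ℂ)) • H) s - rotation E ω s b T‖ :=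
        norm_inner_le_norm _ _
    _ ≤ |ω| * ‖b - w‖ * T := by
        rw [hw, one_mul]
        exact norm_exp_sub_rotation_le hH hs hb hT

end Evolution

section Partner

variable {V ι : Type*} [NormedAddCommGroup V] [InnerProductSpace ℂ V]

/-- The state into which the search rotates the eigenvector `x_0`, for a marked state
`w = x_0 + ∑ x_i` whose components `x_i` have eigenvalues `μ - g_i`, where `μ` is that of `x_0`. -/
def partner (s : Finset ι) (x : ι → V) (g : ι → ℝ) (γ : ℝ) : V :=
  ∑ i ∈ s, (((γ * g i)⁻¹ : ℝ) : ℂ) • x i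

variable {s : Finset ι} {x : ι → V} {g : ι → ℝ} {γ : ℝ} {w : V}

theorem inner_partner (hx : ∀ i ∈ s, inner ℂ w (x i) = (‖x i‖ : ℂ) ^ 2) (hγ0 : γ ≠ 0)
    (hγ : γ = ∑ i ∈ s, ‖x i‖ ^ 2 / g i) : inner ℂ w (partner s x g γ) = 1 := by
  have hterm : ∀ i ∈ s, inner ℂ w ((((γ * g i)⁻¹ : ℝ) : ℂ) • x i) =
      ((γ⁻¹ * (‖x i‖ ^ 2 / g i) : ℝ) : ℂ) := fun i hi => by
    rw [inner_smul_right, hx i hi]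
    push_cast
    ring
  rw [partner, inner_sum, Finset.sum_congr rfl hterm, ← Complex.ofReal_sum, ← Finset.mul_sum,
    ← hγ, inv_mul_cancel₀ hγ0, Complex.ofReal_one]

theorem map_partner {A : V →ₗ[ℂ] V} {μ : ℝ}
    (hA : ∀ i ∈ s, A (x i) = ((μ - g i : ℝ) : ℂ) • x i) (hg : ∀ i ∈ s, g i ≠ 0) (hγ0 : γ ≠ 0) :
    (γ : ℂ) • A (partner s x g γ) =
      ((γ * μ : ℝ) : ℂ) • partner s x g γ - ∑ i ∈ s, x i := by
  simp only [partner, map_sum, map_smul, Finset.smul_sum]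
  rw [← Finset.sum_sub_distrib]
  refine Finset.sum_congr rfl fun i hi => ?_
  have hgi : (g i : ℂ) ≠ 0 := by exact_mod_cast hg i hi
  have hγ' : (γ : ℂ) ≠ 0 := by exact_mod_cast hγ0
  rw [hA i hi]
  match_scalars
  field_simp

theorem norm_partner_sub_sq (hx : (s : Set ι).Pairwise fun i j => inner ℂ (x i) (x j) = 0)
    (hw : ‖w‖ = 1) (hwb : inner ℂ w (partner s x g γ) = 1) :
    ‖partner s x g γ - w‖ ^ 2 = ∑ i ∈ s, ‖x i‖ ^ 2 / (γ * g i) ^ 2 - 1 := by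
  have hnorm : ‖partner s x g γ‖ ^ 2 = ∑ i ∈ s, ‖x i‖ ^ 2 / (γ * g i) ^ 2 := by
    rw [partner, norm_sq_sum_smul_of_pairwise_inner_eq_zero hx]
    refine Finset.sum_congr rfl fun i _ => ?_
    rw [Complex.norm_real, Real.norm_eq_abs, sq_abs, inv_pow, div_eq_inv_mul]
  rw [norm_sub_rev, norm_sub_sq (𝕜 := ℂ), hwb, hw, hnorm, RCLike.one_re]
  ring

end Partner

section Parameters

variable {n k l : ℕ}

theorem eps_nonneg (n : ℕ) : 0 ≤ eps n := one_div_nonneg.2 (Real.sqrt_nonneg _)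

theorem eps_sq (n : ℕ) : eps n ^ 2 = 1 / (n : ℝ) := by
  rw [eps, div_pow, one_pow, Real.sq_sqrt (Nat.cast_nonneg n)]

theorem r_eps (hn : 0 < n) (k l : ℕ) : r k l (eps n) = eps n ^ 2 * eigenval n k l := by
  have hn' : (n : ℝ) ≠ 0 := by exact_mod_cast hn.ne'
  rw [r, eigenval, eps_sq]
  field_simp
  ring

theorem p_nonneg (k l : ℕ) {ε : ℝ} (hε : 0 ≤ ε) : 0 ≤ p k l ε :=
  mul_nonneg (pow_nonneg hε _) (Real.sqrt_nonneg _)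

theorem prod_Icc_one_sub_mul_eps_sq (hn : 0 < n) (hl : l ≤ k) (hk : k ≤ n) :
    ∏ j ∈ Finset.Icc l k, (1 - ((j : ℝ) - 1) * eps n ^ 2) =
      (n + 1 - l).factorial / (n - k).factorial / (n : ℝ) ^ (k + 1 - l) := by
  have hn' : (n : ℝ) ≠ 0 := by exact_mod_cast hn.ne'
  have hterm (i : ℕ) :
      1 - (((l + i : ℕ) : ℝ) - 1) * eps n ^ 2 = (((n + 1 - l : ℕ) : ℝ) - i) / n := by
    rw [eps_sq, Nat.cast_sub (by omega)]
    field_simp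
    push_cast
    ring
  rw [← Finset.Ico_add_one_right_eq_Icc, Finset.prod_Ico_eq_prod_range]
  simp only [hterm]
  rw [Finset.prod_div_distrib, Finset.prod_const, Finset.card_range,
    prod_range_natCast_sub_eq_div (by omega), show n + 1 - l - (k + 1 - l) = n - k by omega]

theorem p_eps_sq (hn0 : 0 < n) (hn : 2 * k ≤ n) (hl : l ≤ k) :
    p k l (eps n) ^ 2 =
      (k.factorial : ℝ) * (n - k).factorial * (n + 1 - 2 * l) /
        (l.factorial * (n + 1 - l).factorial) := by
  have hnum : 1 - (2 * (l : ℝ) - 1) * eps n ^ 2 = (n + 1 - 2 * l) / n := by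
    rw [eps_sq]
    field_simp
    ring
  have hgap : (0 : ℝ) ≤ n + 1 - 2 * l := by
    have : (2 * l : ℝ) ≤ n := by exact_mod_cast (by omega : 2 * l ≤ n)
    linarith
  rw [p, mul_pow, prod_Icc_one_sub_mul_eps_sq hn0 hl (by omega), hnum,
    Real.sq_sqrt (by positivity), ← pow_mul, mul_comm (k - l), pow_mul, eps_sq, div_pow, one_pow,
    Nat.succ_sub hl, pow_succ]
  field_simp

theorem p_eps_eq_norm (hn0 : 0 < n) (hn : 2 * k ≤ n) (hl : l ≤ k) (w : Vertex n k) :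
    p k l (eps n) = ‖eigenProj n k l (ket w)‖ := by
  rw [← sq_eq_sq₀ (p_nonneg k l (eps_nonneg n)) (norm_nonneg _), p_eps_sq hn0 hn hl,
    norm_eigenProj_ket_sq hn hl w]

theorem p_eps_sq_pos (hn0 : 0 < n) (hn : 2 * k ≤ n) (hl : l ≤ k) : 0 < p k l (eps n) ^ 2 := by
  have hgap : (0 : ℝ) < n + 1 - 2 * l := by
    have : (2 * l : ℝ) ≤ n := by exact_mod_cast (by omega : 2 * l ≤ n)
    linarith
  rw [p_eps_sq hn0 hn hl]
  positivity

theorem gammaCirc_eps (hn : 0 < n) (k : ℕ) :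
    gammaCirc k (eps n) =
      ∑ l ∈ Finset.Icc 1 k, p k l (eps n) ^ 2 / (eigenval n k 0 - eigenval n k l) := by
  have hε : eps n ^ 2 ≠ 0 := by
    rw [eps_sq]
    exact one_div_ne_zero (Nat.cast_ne_zero.2 hn.ne')
  rw [gammaCirc, Finset.mul_sum]
  refine Finset.sum_congr rfl fun l _ => ?_
  rw [r_eps hn, r_eps hn, ← mul_sub, mul_div_assoc', mul_div_mul_left _ _ hε]

theorem eigenval_lt_eigenval_zero (hn : 2 * k ≤ n) (hl : l ∈ Finset.Icc 1 k) :
    eigenval n k l < eigenval n k 0 := by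
  obtain ⟨hl0, hlk⟩ := Finset.mem_Icc.1 hl
  exact strictAntiOn_eigenval hn k.zero_le hlk hl0

theorem gammaCirc_eps_pos (hk : 1 ≤ k) (hn : 2 * k ≤ n) : 0 < gammaCirc k (eps n) := by
  rw [gammaCirc_eps (by omega)]
  exact Finset.sum_pos (fun l hl => div_pos (p_eps_sq_pos (by omega) hn (Finset.mem_Icc.1 hl).2)
    (sub_pos.2 (eigenval_lt_eigenval_zero hn hl))) ⟨1, Finset.mem_Icc.2 ⟨le_rfl, hk⟩⟩

end Parameters

section Hamiltonian

variable {n k : ℕ}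

theorem hamiltonian_apply (γ : ℝ) (w : Vertex n k) (x : State n k) :
    hamiltonian γ w x = -((γ : ℂ) • adjOp n k x) - inner ℂ (ket w) x • ket w := by
  simp [hamiltonian, InnerProductSpace.rankOne_apply]

theorem isSelfAdjoint_hamiltonian (γ : ℝ) (w : Vertex n k) : IsSelfAdjoint (hamiltonian γ w) := by
  have hadj : IsSelfAdjoint (adjOp n k) := (isSymmetric_adjOp n k).isSelfAdjoint
  have hmark : IsSelfAdjoint (InnerProductSpace.rankOne ℂ (ket w) (ket w)) :=
    (InnerProductSpace.isSymmetric_rankOne_self (ket w)).isSelfAdjoint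
  have hγ : IsSelfAdjoint (γ : ℂ) := Complex.conj_ofReal γ
  exact (hγ.smul hadj).neg.sub hmark

theorem norm_ket (v : Vertex n k) : ‖ket v‖ = 1 := by
  rw [ket, PiLp.norm_single, norm_one]

theorem inner_ket_uniformState (w : Vertex n k) :
    inner ℂ (ket w) (uniformState n k) = ((1 / √(n.choose k : ℝ) : ℝ) : ℂ) := by
  rw [inner_ket, uniformState, PiLp.smul_apply, ← subsetCount_zero ∅, subsetCount_apply,
    Nat.choose_zero_right, Nat.cast_one, smul_eq_mul, mul_one]

theorem adjOp_uniformState (n k : ℕ) :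
    adjOp n k (uniformState n k) = (eigenval n k 0 : ℂ) • uniformState n k := by
  rw [uniformState, map_smul, ← subsetCount_zero ∅, smul_comm]
  exact congrArg _ (isLadder_subsetCount n k ∅).zero

theorem hamiltonian_uniformState (γ : ℝ) (w : Vertex n k) :
    hamiltonian γ w (uniformState n k) =
      ((-(γ * eigenval n k 0) : ℝ) : ℂ) • uniformState n k -
        ((1 / √(n.choose k : ℝ) : ℝ) : ℂ) • ket w := by
  rw [hamiltonian_apply, adjOp_uniformState, inner_ket_uniformState, smul_smul]
  push_cast
  rw [neg_smul]

theorem inner_ket_eigenProj (w : Vertex n k) (l : ℕ) :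
    inner ℂ (ket w) (eigenProj n k l (ket w)) = (‖eigenProj n k l (ket w)‖ : ℂ) ^ 2 :=
  inner_self_starProjection _ _

theorem sum_Icc_eigenProj_ket (hn : 2 * k ≤ n) (w : Vertex n k) :
    ∑ l ∈ Finset.Icc 1 k, eigenProj n k l (ket w) =
      ket w - ((1 / √(n.choose k : ℝ) : ℝ) : ℂ) • uniformState n k := by
  have hsum := sum_eigenProj_ket hn w
  rw [Finset.range_eq_Ico, Finset.sum_eq_sum_Ico_succ_bot k.succ_pos, eigenProj_zero_ket hn,
    zero_add, Nat.succ_eq_add_one, Finset.Ico_add_one_right_eq_Icc] at hsum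
  exact eq_sub_of_add_eq' hsum

/-- `S_j(ε) = ∑_{ℓ=1}^k p_ℓ(ε)² / (r_0(ε) - r_ℓ(ε))^j`. Here `γ° = ε² S_1`, and `S_2 / S_1²` is the
squared norm of the partner state. -/
def spectralSum (j k : ℕ) (ε : ℝ) : ℝ :=
  ∑ l ∈ Finset.Icc 1 k, p k l ε ^ 2 / (r k 0 ε - r k l ε) ^ j

theorem gammaCirc_eps_mul_sub (hn : 0 < n) (k l : ℕ) :
    gammaCirc k (eps n) * (eigenval n k 0 - eigenval n k l) =
      spectralSum 1 k (eps n) * (r k 0 (eps n) - r k l (eps n)) := by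
  simp only [gammaCirc, spectralSum, pow_one, r_eps hn]
  ring

theorem exists_hamiltonian_partner (hk : 1 ≤ k) (hn : 2 * k ≤ n) (w : Vertex n k) :
    ∃ b : State n k, inner ℂ (ket w) b = 1 ∧
      hamiltonian (gammaCirc k (eps n)) w b =
        ((-(gammaCirc k (eps n) * eigenval n k 0) : ℝ) : ℂ) • b -
          ((1 / √(n.choose k : ℝ) : ℝ) : ℂ) • uniformState n k ∧
      ‖b - ket w‖ ^ 2 = spectralSum 2 k (eps n) / spectralSum 1 k (eps n) ^ 2 - 1 := by
  have hn0 : 0 < n := by omega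
  have hγ0 := (gammaCirc_eps_pos hk hn).ne'
  have hp : ∀ l ∈ Finset.Icc 1 k, p k l (eps n) = ‖eigenProj n k l (ket w)‖ :=
    fun l hl => p_eps_eq_norm hn0 hn (Finset.mem_Icc.1 hl).2 w
  have hgap : ∀ l ∈ Finset.Icc 1 k, eigenval n k 0 - eigenval n k l ≠ 0 :=
    fun l hl => (sub_pos.2 (eigenval_lt_eigenval_zero hn hl)).ne'
  have hγ : gammaCirc k (eps n) = ∑ l ∈ Finset.Icc 1 k,
      ‖eigenProj n k l (ket w)‖ ^ 2 / (eigenval n k 0 - eigenval n k l) := by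
    rw [gammaCirc_eps hn0]
    exact Finset.sum_congr rfl fun l hl => by rw [hp l hl]
  have horth : ((Finset.Icc 1 k : Finset ℕ) : Set ℕ).Pairwise fun i j =>
      inner ℂ (eigenProj n k i (ket w)) (eigenProj n k j (ket w)) = 0 := fun i hi j hj hij =>
    inner_eigenProj_eigenProj ((strictAntiOn_eigenval hn).injOn.ne (Finset.mem_Icc.1 hi).2
      (Finset.mem_Icc.1 hj).2 hij) _ _
  have hwb := inner_partner (fun l _ => inner_ket_eigenProj w l) hγ0 hγ
  refine ⟨_, hwb, ?_, ?_⟩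
  · rw [hamiltonian_apply, hwb]
    have hmap := map_partner (A := (adjOp n k).toLinearMap) (μ := eigenval n k 0)
      (x := fun l => eigenProj n k l (ket w))
      (fun l _ => by rw [sub_sub_cancel]; exact adjOp_eigenProj n k l (ket w)) hgap hγ0
    rw [ContinuousLinearMap.coe_coe] at hmap
    rw [hmap, sum_Icc_eigenProj_ket hn]
    push_cast
    module
  · rw [norm_partner_sub_sq horth (norm_ket w) hwb, spectralSum, Finset.sum_div]
    congr 1
    refine Finset.sum_congr rfl fun l hl => ?_
    rw [hp l hl, gammaCirc_eps_mul_sub hn0, mul_pow, div_div, mul_comm]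

/-- Bound for the distance of `|⟨w|ψ(t_run)⟩|` from `|sin (t_run/√N)|`: the Duhamel error, and then
the part of the rotation left along the uniform state. -/
def amplitudeError (n k : ℕ) : ℝ :=
  runTime n k * (1 / √(n.choose k : ℝ)) *
      √(spectralSum 2 k (eps n) / spectralSum 1 k (eps n) ^ 2 - 1) +
    |Real.cos (runTime n k * (1 / √(n.choose k : ℝ)))|

theorem runTime_nonneg (n k : ℕ) : 0 ≤ runTime n k := by
  rw [runTime]
  positivity

theorem abs_amplitude_sub_abs_sin_le (hk : 1 ≤ k) (hn : 2 * k ≤ n) (w : Vertex n k) :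
    |‖inner ℂ (ket w) (stateAt (gammaCirc k (eps n)) w (runTime n k))‖ -
      abs (Real.sin (runTime n k * (1 / √(n.choose k : ℝ))))| ≤ amplitudeError n k := by
  obtain ⟨b, hwb, hHb, hb⟩ := exists_hamiltonian_partner hk hn w
  have hω : 0 ≤ 1 / √(n.choose k : ℝ) := by positivity
  have hω_le : 1 / √(n.choose k : ℝ) ≤ 1 := by
    have hN : (1 : ℝ) ≤ n.choose k := Nat.one_le_cast.2 (Nat.choose_pos (by omega))
    exact div_le_one_of_le₀ (Real.one_le_sqrt.2 hN) (Real.sqrt_nonneg _)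
  have hsearch := abs_norm_inner_exp_sub_abs_sin_le
    (isSelfAdjoint_hamiltonian (gammaCirc k (eps n)) w) (hamiltonian_uniformState _ w) hHb
    (norm_ket w) hwb (runTime_nonneg n k)
  rw [inner_ket_uniformState, Complex.norm_real, Real.norm_of_nonneg hω, abs_of_nonneg hω,
    ← Real.sqrt_sq (norm_nonneg (b - ket w)), hb] at hsearch
  refine hsearch.trans (add_le_add (le_of_eq (by ring)) ?_)
  exact mul_le_of_le_one_right (abs_nonneg _) hω_le

end Hamiltonian

section Limit

variable {k : ℕ}

theorem continuousAt_p (k l : ℕ) : ContinuousAt (p k l) 0 := by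
  unfold p
  refine ContinuousAt.mul (by fun_prop) (ContinuousAt.sqrt (ContinuousAt.div (by fun_prop)
    (continuousAt_const.mul ?_) ?_))
  · exact (continuous_finsetProd _ fun j _ => by fun_prop).continuousAt
  · simp [Nat.factorial_ne_zero]

theorem p_self_zero (k : ℕ) : p k k 0 = 1 := by
  simp [p, Nat.factorial_ne_zero]

theorem p_zero_of_lt {l : ℕ} (h : l < k) : p k l 0 = 0 := by
  simp [p, Nat.sub_ne_zero_of_lt h]

theorem continuous_r (k l : ℕ) : Continuous (r k l) := by
  unfold r
  fun_prop

theorem r_zero_sub_r_zero (k l : ℕ) : r k 0 0 - r k l 0 = l := by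
  simp [r]

theorem spectralSum_zero (hk : 1 ≤ k) (j : ℕ) : spectralSum j k 0 = 1 / (k : ℝ) ^ j := by
  rw [spectralSum, Finset.sum_eq_single_of_mem k (Finset.mem_Icc.2 ⟨hk, le_rfl⟩), p_self_zero,
    r_zero_sub_r_zero, one_pow]
  intro l hl hlk
  rw [p_zero_of_lt (lt_of_le_of_ne (Finset.mem_Icc.1 hl).2 hlk), zero_pow two_ne_zero, zero_div]

theorem continuousAt_spectralSum (j k : ℕ) : ContinuousAt (spectralSum j k) 0 := by
  unfold spectralSum
  refine tendsto_finsetSum _ fun l hl => ((continuousAt_p k l).pow 2).div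
    (((continuous_r k 0).sub (continuous_r k l)).continuousAt.pow j) ?_
  have hl0 : (l : ℝ) ≠ 0 := Nat.cast_ne_zero.2 (Nat.one_le_iff_ne_zero.1 (Finset.mem_Icc.1 hl).1)
  exact pow_ne_zero j ((r_zero_sub_r_zero k l).trans_ne hl0)

theorem tendsto_spectralSum_ratio (hk : 1 ≤ k) :
    Tendsto (fun ε => spectralSum 2 k ε / spectralSum 1 k ε ^ 2 - 1) (𝓝 0) (𝓝 0) := by
  have hk0 : (k : ℝ) ≠ 0 := Nat.cast_ne_zero.2 (by omega)
  have hS₁ : spectralSum 1 k 0 ^ 2 ≠ 0 := by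
    rw [spectralSum_zero hk]
    positivity
  have hlim := (((continuousAt_spectralSum 2 k).div ((continuousAt_spectralSum 1 k).pow 2)
    hS₁).tendsto).sub_const 1
  have hratio : spectralSum 2 k 0 / spectralSum 1 k 0 ^ 2 = 1 := by
    rw [spectralSum_zero hk, spectralSum_zero hk]
    field_simp
  simpa only [Pi.div_apply, Pi.pow_apply, hratio, sub_self] using hlim

theorem tendsto_eps : Tendsto eps atTop (𝓝 0) := by
  unfold eps
  simp only [one_div]
  exact tendsto_inv_atTop_zero.comp (Real.tendsto_sqrt_atTop.comp tendsto_natCast_atTop_atTop)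

theorem runTime_eq (n k : ℕ) : runTime n k = Real.pi / 2 * √((n : ℝ) ^ k / k.factorial) := by
  have hsqrt : √((n : ℝ) ^ k) = (n : ℝ) ^ ((k : ℝ) / 2) := by
    rw [Real.sqrt_eq_rpow, ← Real.rpow_natCast, ← Real.rpow_mul (Nat.cast_nonneg n), mul_one_div]
  rw [Real.sqrt_div' _ (Nat.cast_nonneg _), hsqrt, runTime, div_mul_div_comm]

theorem tendsto_runTime_div (k : ℕ) :
    Tendsto (fun n : ℕ => runTime n k / (Real.pi * √(n.choose k : ℝ) / 2)) atTop (𝓝 1) := by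
  have hchoose : Tendsto ((fun n : ℕ => (n : ℝ) ^ k / k.factorial) / fun n : ℕ => (n.choose k : ℝ))
      atTop (𝓝 1) := by
    refine (Asymptotics.isEquivalent_iff_tendsto_one ?_).1 (isEquivalent_choose k).symm
    filter_upwards [eventually_ge_atTop k] with n hn
    exact_mod_cast (Nat.choose_pos hn).ne'
  have hsqrt := hchoose.sqrt
  rw [Real.sqrt_one] at hsqrt
  refine hsqrt.congr fun n => ?_
  rw [Pi.div_apply, Real.sqrt_div' _ (Nat.cast_nonneg _), runTime_eq, mul_div_right_comm Real.pi,
    mul_div_mul_left _ _ (by positivity)]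

theorem tendsto_runTime_mul (k : ℕ) :
    Tendsto (fun n : ℕ => runTime n k * (1 / √(n.choose k : ℝ))) atTop (𝓝 (Real.pi / 2)) := by
  have hlim := (tendsto_runTime_div k).mul_const (Real.pi / 2)
  rw [one_mul] at hlim
  refine hlim.congr fun n => ?_
  field_simp

theorem tendsto_amplitudeError (hk : 1 ≤ k) :
    Tendsto (fun n => amplitudeError n k) atTop (𝓝 0) := by
  have hpartner := ((tendsto_spectralSum_ratio hk).comp tendsto_eps).sqrt
  have hcos := ((Real.continuous_cos.tendsto _).comp (tendsto_runTime_mul k)).abs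
  have hlim := ((tendsto_runTime_mul k).mul hpartner).add hcos
  rwa [Real.sqrt_zero, mul_zero, Real.cos_pi_div_two, abs_zero, add_zero] at hlim

theorem abs_sq_sub_one_le {a e : ℝ} (h : |a - 1| ≤ e) : |a ^ 2 - 1| ≤ e * (e + 2) := by
  have he : 0 ≤ e := (abs_nonneg _).trans h
  have hsum : |a + 1| ≤ e + 2 :=
    calc |a + 1| = |(a - 1) + 2| := by ring_nf
      _ ≤ |a - 1| + |2| := abs_add_le _ _
      _ ≤ e + 2 := by rw [abs_two]; gcongr
  rw [show a ^ 2 - 1 = (a - 1) * (a + 1) by ring, abs_mul]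
  gcongr

theorem eventually_abs_successProb_sub_one_lt (hk : 1 ≤ k) {δ : ℝ} (hδ : 0 < δ) :
    ∀ᶠ n : ℕ in atTop, ∀ w : Vertex n k,
      |successProb (gammaCirc k (eps n)) w (runTime n k) - 1| < δ := by
  have hsin : Tendsto (fun n : ℕ => |abs (Real.sin (runTime n k * (1 / √(n.choose k : ℝ)))) - 1|)
      atTop (𝓝 0) := by
    have hlim := (((Real.continuous_sin.tendsto _).comp (tendsto_runTime_mul k)).abs.sub_const
      1).abs
    simpa only [Function.comp_apply, Real.sin_pi_div_two, abs_one, sub_self, abs_zero] using hlim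
  have herror := (tendsto_amplitudeError hk).add hsin
  have hlim := herror.mul (herror.add_const 2)
  rw [add_zero, zero_mul] at hlim
  filter_upwards [eventually_ge_atTop (2 * k), hlim.eventually_lt_const hδ] with n hn hlt w
  exact (abs_sq_sub_one_le ((abs_sub_le _ _ _).trans
    (add_le_add_left (abs_amplitude_sub_abs_sin_le hk hn w) _))).trans_lt hlt

end Limit

end JohnsonSearch

end

theorem mainTheorem1 (k : ℕ) (hk : 1 ≤ k) :
    -- `γ°` is positive, and `r_ℓ`, `p_ℓ` are `ε² λ_ℓ` and `‖P_ℓ|w⟩‖` at `ε = 1/√n`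
    (∀ n : ℕ, 2 * k ≤ n →
      0 < JohnsonSearch.gammaCirc k (JohnsonSearch.eps n) ∧
      ∀ l ≤ k,
        JohnsonSearch.r k l (JohnsonSearch.eps n)
          = JohnsonSearch.eps n ^ 2 * JohnsonSearch.eigenval n k l ∧
        ∀ w : JohnsonSearch.Vertex n k,
          JohnsonSearch.p k l (JohnsonSearch.eps n)
            = ‖JohnsonSearch.eigenProj n k l (JohnsonSearch.ket w)‖) ∧
    -- `t_run ~ π√N/2`
    Tendsto (fun n : ℕ => JohnsonSearch.runTime n k / (Real.pi * √(n.choose k : ℝ) / 2))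
      atTop (𝓝 1) ∧
    -- the success probability is `1 + o(1)`, uniformly in the marked vertex
    ∀ δ : ℝ, 0 < δ → ∀ᶠ n : ℕ in atTop, ∀ w : JohnsonSearch.Vertex n k,
      |JohnsonSearch.successProb (JohnsonSearch.gammaCirc k (JohnsonSearch.eps n)) w
          (JohnsonSearch.runTime n k) - 1| < δ := by
  refine ⟨fun n hn => ⟨JohnsonSearch.gammaCirc_eps_pos hk hn, fun l hl =>
      ⟨JohnsonSearch.r_eps (by omega) k l, JohnsonSearch.p_eps_eq_norm (by omega) hn hl⟩⟩,
    JohnsonSearch.tendsto_runTime_div k,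
    fun δ hδ => JohnsonSearch.eventually_abs_successProb_sub_one_lt hk hδ⟩
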